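/- Let $\mathbb K$ be an algebraically closed field. A symmetric Frobenius algebra $(A,\lambda^A)$ is an associative unital $\mathbb K$-algebra $A$ with a linear form $\lambda^A:A\to\mathbb K$ such that $\lambda^A(ab)=\lambda^A(ba)$ for all $a,b$ and the pairing $a\otimes b\mapsto\lambda^A(ab)$ is non-degenerate. If $A$ is semisimple and $X$ is a finitely generated left $A$-module, put $X^*=\operatorname{Hom}_A(X,A)$; the map $\Psi:X^*\otimes_A X\to\operatorname{End}_A(X)$, $f\otimes x\mapsto(y\mapsto f(y).x)$, is bijective, and the trace $\operatorname{tr}^{\lambda^A}_X:\operatorname{End}_A(X)\to\mathbb K$ is $\Psi^{-1}$ followed by $f\otimes x\mapsto\lambda^A(f(x))$. These traces form the Calabi–Yau structure on the category $(A\text{-Mod})^{fg}$ of finitely generated left $A$-modules. A Morita context $\mathcal M=(M,N,\varepsilon,\eta)$ between $\mathbb K$-algebras $A$ and $B$ consists of a $(B,A)$-bimodule $M$, an $(A,B)$-bimodule $N$ (with $\mathbb K$ acting in the same way from both sides), and isomorphisms of bimodules $\varepsilon:N\otimes_B M\to A$ and $\eta:B\to M\otimes_A N$ such that $m.\varepsilon(n\otimes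 m')=\eta^{-1}(m\otimes n).m'$ and $\varepsilon(n\otimes m).n'=n.\eta^{-1}(m\otimes n')$ for all $m,m'\in M$, $n,n'\in N$. It is compatible with Frobenius forms $\lambda^A,\lambda^B$ if, writing $\varepsilon^{-1}(1_A)=\sum_i n_i\otimes m_i$, one has $\lambda^A(a)=\sum_i\lambda^B\big(\eta^{-1}(m_i.a\otimes n_i)\big)$ for all $a\in A$. Write $\operatorname{Rep}^{fg}(\mathcal M)=M\otimes_A-:(A\text{-Mod})^{fg}\to(B\text{-Mod})^{fg}$. **Proposition.** Let $(A,\lambda^A)$ and $(B,\lambda^B)$ be semisimple symmetric Frobenius algebras over $\mathbb K$, and let $F:(A\text{-Mod})^{fg}\to(B\text{-Mod})^{fg}$ be an equivalence of Calabi–Yau categories, that is, a $\mathbb K$-linear equivalence of categories such that $\operatorname{tr}^{\lambda^A}_X(f)=\operatorname{tr}^{\lambda^B}_{F(X)}(F(f))$ for every finitely generated left $A$-module $X$ and every $f\in\operatorname{End}_A(X)$. Then there is a Morita context $\mathcal M$ between $A$ and $B$, compatible with $\lambda^A$ and $\lambda^B$, such that $\operatorname{Rep}^{fg}(\mathcal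 M)$ is naturally isomorphic to $F$. -/

import Mathlib

open CategoryTheory MulOpposite
open scoped TensorProduct

universe u v

noncomputable section

/-! ### Tensor products over a noncommutative ring

A right `A`-module is a module over `Aᵐᵒᵖ`; the element `m.a` is written `op a • m`. -/

/-- The relations `m.a ⊗ x = m ⊗ a.x`. -/
def balancedRel (A M X : Type*) [Ring A] [AddCommGroup M] [Module Aᵐᵒᵖ M]
    [AddCommGroup X] [Module A X] : Submodule ℤ (M ⊗[ℤ] X) :=
  Submodule.span ℤ {z | ∃ (m : M) (a : A) (x : X), z = (op a • m) ⊗ₜ[ℤ] x - m ⊗ₜ[ℤ] (a • x)}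

/-- The tensor product `M ⊗_A X` of a right `A`-module `M` and a left `A`-module `X`. -/
def BalTensor (A M X : Type*) [Ring A] [AddCommGroup M] [Module Aᵐᵒᵖ M]
    [AddCommGroup X] [Module A X] : Type _ :=
  (M ⊗[ℤ] X) ⧸ balancedRel A M X

namespace BalTensor

section Basic

variable {A M X : Type*} [Ring A] [AddCommGroup M] [Module Aᵐᵒᵖ M] [AddCommGroup X] [Module A X]

instance : AddCommGroup (BalTensor A M X) :=
  inferInstanceAs (AddCommGroup ((M ⊗[ℤ] X) ⧸ balancedRel A M X))

variable (A) in
/-- The pure tensor `m ⊗ x` in `M ⊗_A X`. -/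
def tmul (m : M) (x : X) : BalTensor A M X :=
  (balancedRel A M X).mkQ (m ⊗ₜ[ℤ] x)

theorem add_tmul (m m' : M) (x : X) : tmul A (m + m') x = tmul A m x + tmul A m' x := by
  simp only [tmul, TensorProduct.add_tmul]
  exact map_add _ _ _

theorem tmul_add (m : M) (x x' : X) : tmul A m (x + x') = tmul A m x + tmul A m x' := by
  simp only [tmul, TensorProduct.tmul_add]
  exact map_add _ _ _

theorem smul_tmul (m : M) (a : A) (x : X) : tmul A (op a • m) x = tmul A m (a • x) :=
  (Submodule.Quotient.eq _).2 (Submodule.subset_span ⟨m, a, x, rfl⟩)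

/-- `m ⊗ x` as a biadditive map. -/
def tmulHom : M →+ X →+ BalTensor A M X :=
  AddMonoidHom.mk' (fun m => AddMonoidHom.mk' (fun x => tmul A m x) (tmul_add m))
    (fun m m' => by ext x; exact add_tmul m m' x)

theorem tmul_zero (m : M) : tmul A m (0 : X) = 0 := map_zero (tmulHom (A := A) m)

theorem tmul_sum {ι : Type*} (s : Finset ι) (m : M) (x : ι → X) :
    tmul A m (∑ i ∈ s, x i) = ∑ i ∈ s, tmul A m (x i) :=
  map_sum (tmulHom (A := A) m) x s

theorem sum_tmul {ι : Type*} (s : Finset ι) (m : ι → M) (x : X) :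
    tmul A (∑ i ∈ s, m i) x = ∑ i ∈ s, tmul A (m i) x :=
  map_sum ((tmulHom (A := A) (M := M) (X := X)).flip x) m s

theorem induction_on {p : BalTensor A M X → Prop} (z : BalTensor A M X)
    (zero : p 0) (tmul : ∀ m x, p (tmul A m x)) (add : ∀ y z, p y → p z → p (y + z)) : p z := by
  obtain ⟨t, rfl⟩ := (balancedRel A M X).mkQ_surjective z
  induction t using TensorProduct.induction_on with
  | zero => rw [map_zero]; exact zero
  | tmul m x => exact tmul m x
  | add a b ha hb => rw [map_add]; exact add _ _ ha hb

/-- The universal property: balanced biadditive maps factor through `M ⊗_A X`. -/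
def lift {P : Type*} [AddCommGroup P] (φ : M →+ X →+ P)
    (hφ : ∀ (m : M) (a : A) (x : X), φ (op a • m) x = φ m (a • x)) : BalTensor A M X →+ P :=
  ((balancedRel A M X).liftQ
    (TensorProduct.liftAddHom (R := ℤ) φ (fun r m x => by simp)).toIntLinearMap (by
      refine Submodule.span_le.2 ?_
      rintro _ ⟨m, a, x, rfl⟩
      simp [hφ])).toAddMonoidHom

@[simp]
theorem lift_tmul {P : Type*} [AddCommGroup P] (φ : M →+ X →+ P)
    (hφ : ∀ (m : M) (a : A) (x : X), φ (op a • m) x = φ m (a • x)) (m : M) (x : X) :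
    lift φ hφ (tmul A m x) = φ m x := rfl

end Basic

section Map

variable {A M M' X X' : Type*} [Ring A] [AddCommGroup M] [Module Aᵐᵒᵖ M]
  [AddCommGroup M'] [Module Aᵐᵒᵖ M'] [AddCommGroup X] [Module A X] [AddCommGroup X'] [Module A X']

/-- The map `g ⊗ h : M ⊗_A X → M' ⊗_A X'`. -/
def map (g : M →ₗ[Aᵐᵒᵖ] M') (h : X →ₗ[A] X') : BalTensor A M X →+ BalTensor A M' X' :=
  lift (((tmulHom (A := A)).comp g.toAddMonoidHom).compl₂ h.toAddMonoidHom)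
    (fun m a x => by
      change tmul A (g (op a • m)) (h x) = tmul A (g m) (h (a • x))
      rw [map_smul, map_smul, smul_tmul])

@[simp]
theorem map_tmul (g : M →ₗ[Aᵐᵒᵖ] M') (h : X →ₗ[A] X') (m : M) (x : X) :
    map g h (tmul A m x) = tmul A (g m) (h x) := rfl

end Map

section Actions

variable {A M X : Type*} [Ring A] [AddCommGroup M] [Module Aᵐᵒᵖ M] [AddCommGroup X] [Module A X]

/-- The left action `b.(m ⊗ x) = (b.m) ⊗ x` on `M ⊗_A X` for a bimodule `M`. -/
instance leftModule {B : Type*} [Ring B] [Module B M] [SMulCommClass B Aᵐᵒᵖ M] :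
    Module B (BalTensor A M X) where
  smul b z := map (Module.toModuleEnd Aᵐᵒᵖ M b) LinearMap.id z
  one_smul z := by
    change map (Module.toModuleEnd Aᵐᵒᵖ M 1) LinearMap.id z = z
    induction z using induction_on with
    | zero => exact map_zero _
    | tmul m x => simp
    | add y z hy hz => rw [map_add, hy, hz]
  mul_smul b c z := by
    change map (Module.toModuleEnd Aᵐᵒᵖ M (b * c)) LinearMap.id z =
      map (Module.toModuleEnd Aᵐᵒᵖ M b) LinearMap.id
        (map (Module.toModuleEnd Aᵐᵒᵖ M c) LinearMap.id z)
    induction z using induction_on with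
    | zero => simp only [map_zero]
    | tmul m x => simp [mul_smul]
    | add y z hy hz => simp only [map_add, hy, hz]
  smul_zero b := map_zero _
  smul_add b := map_add _
  add_smul b c z := by
    change map (Module.toModuleEnd Aᵐᵒᵖ M (b + c)) LinearMap.id z =
      map (Module.toModuleEnd Aᵐᵒᵖ M b) LinearMap.id z +
        map (Module.toModuleEnd Aᵐᵒᵖ M c) LinearMap.id z
    induction z using induction_on with
    | zero => simp only [map_zero, add_zero]
    | tmul m x => simp only [map_tmul, map_add, LinearMap.add_apply, add_tmul]
    | add y z hy hz => rw [AddMonoidHom.map_add, hy, hz, AddMonoidHom.map_add, AddMonoidHom.map_add]; abel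
  zero_smul z := by
    change map (Module.toModuleEnd Aᵐᵒᵖ M 0) LinearMap.id z = 0
    induction z using induction_on with
    | zero => exact map_zero _
    | tmul m x =>
      rw [map_tmul, map_zero]
      exact map_zero ((tmulHom (A := A) (M := M) (X := X)).flip x)
    | add y z hy hz => rw [map_add, hy, hz, add_zero]

theorem left_smul_tmul {B : Type*} [Ring B] [Module B M] [SMulCommClass B Aᵐᵒᵖ M]
    (b : B) (m : M) (x : X) : b • tmul A m x = tmul A (b • m) x := rfl

/-- Right multiplication by an element of `C` on an `(A, C)`-bimodule, as an `A`-linear map. -/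
def rightMul {C : Type*} [Ring C] [Module Cᵐᵒᵖ X] [SMulCommClass A Cᵐᵒᵖ X] (c : Cᵐᵒᵖ) :
    X →ₗ[A] X where
  toFun x := c • x
  map_add' := smul_add c
  map_smul' a x := (smul_comm a c x).symm

/-- The right action `(m ⊗ x).c = m ⊗ (x.c)` on `M ⊗_A X` for a bimodule `X`. -/
instance rightModule {C : Type*} [Ring C] [Module Cᵐᵒᵖ X] [SMulCommClass A Cᵐᵒᵖ X] :
    Module Cᵐᵒᵖ (BalTensor A M X) where
  smul c z := map LinearMap.id (rightMul c) z
  one_smul z := by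
    change map LinearMap.id (rightMul 1) z = z
    induction z using induction_on with
    | zero => exact map_zero _
    | tmul m x => simp [rightMul]
    | add y z hy hz => rw [map_add, hy, hz]
  mul_smul b c z := by
    change map LinearMap.id (rightMul (b * c)) z =
      map LinearMap.id (rightMul b) (map LinearMap.id (rightMul c) z)
    induction z using induction_on with
    | zero => simp only [map_zero]
    | tmul m x => simp [rightMul, mul_smul]
    | add y z hy hz => simp only [map_add, hy, hz]
  smul_zero b := map_zero _
  smul_add b := map_add _
  add_smul b c z := by
    change map LinearMap.id (rightMul (b + c)) z =
      map LinearMap.id (rightMul b) z + map LinearMap.id (rightMul c) z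
    induction z using induction_on with
    | zero => simp only [map_zero, add_zero]
    | tmul m x => simp [rightMul, add_smul, tmul_add]
    | add y z hy hz => rw [AddMonoidHom.map_add, hy, hz, AddMonoidHom.map_add, AddMonoidHom.map_add]; abel
  zero_smul z := by
    change map LinearMap.id (rightMul 0) z = 0
    induction z using induction_on with
    | zero => exact map_zero _
    | tmul m x => simp [rightMul, tmul_zero]
    | add y z hy hz => rw [map_add, hy, hz, add_zero]

theorem right_smul_tmul {C : Type*} [Ring C] [Module Cᵐᵒᵖ X] [SMulCommClass A Cᵐᵒᵖ X]
    (c : C) (m : M) (x : X) : op c • tmul A m x = tmul A m (op c • x) := rfl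

/-- The `B`-linear map `id_M ⊗ f : M ⊗_A X → M ⊗_A Y`. -/
def lTensor {Y : Type*} [AddCommGroup Y] [Module A Y] (B : Type*) (M : Type*) [Ring B]
    [AddCommGroup M] [Module Aᵐᵒᵖ M] [Module B M] [SMulCommClass B Aᵐᵒᵖ M] (f : X →ₗ[A] Y) :
    BalTensor A M X →ₗ[B] BalTensor A M Y where
  toFun := map LinearMap.id f
  map_add' := map_add _
  map_smul' b z := by
    simp only [RingHom.id_apply]
    induction z using induction_on with
    | zero => simp only [smul_zero, map_zero]
    | tmul m x => rfl
    | add y z hy hz => simp only [smul_add, map_add, hy, hz]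

@[simp]
theorem lTensor_tmul {Y : Type*} [AddCommGroup Y] [Module A Y] (B : Type*) (M : Type*) [Ring B]
    [AddCommGroup M] [Module Aᵐᵒᵖ M] [Module B M] [SMulCommClass B Aᵐᵒᵖ M] (f : X →ₗ[A] Y)
    (m : M) (x : X) : lTensor B M f (tmul A m x) = tmul A m (f x) := rfl

end Actions

end BalTensor

/-! ### Symmetric Frobenius algebras -/

/-- A symmetric Frobenius form on a `K`-algebra `A`: a linear form `lam` with
`lam (a * b) = lam (b * a)` for which the pairing `a ⊗ b ↦ lam (a * b)` is nondegenerate. -/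
structure SymmFrobeniusForm (K : Type*) (A : Type*) [Field K] [Ring A] [Algebra K A] where
  /-- the Frobenius form -/
  form : A →ₗ[K] K
  nondegenerate : ((LinearMap.mul K A).compr₂ form).Nondegenerate
  symm : ∀ a b : A, form (a * b) = form (b * a)

/-! ### Morita contexts -/

/-- The left and right actions on `M` make it a `(B, A)`-bimodule over the field `K`: they
commute with each other and induce the same action of `K`. -/
class IsBimodule (K B A M : Type*) [Field K] [Ring B] [Algebra K B] [Ring A] [Algebra K A]
    [AddCommGroup M] [Module B M] [Module Aᵐᵒᵖ M] : Prop extends SMulCommClass B Aᵐᵒᵖ M where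
  central : ∀ (k : K) (m : M), algebraMap K B k • m = op (algebraMap K A k) • m

/-- An isomorphism of `(B, A)`-bimodules. -/
structure BimoduleIso (B A P Q : Type*) [Ring B] [Ring A]
    [AddCommGroup P] [Module B P] [Module Aᵐᵒᵖ P]
    [AddCommGroup Q] [Module B Q] [Module Aᵐᵒᵖ Q] extends P ≃ₗ[B] Q where
  map_right : ∀ (a : A) (p : P), toFun (op a • p) = op a • toFun p

/-- A Morita context `(M, N, ε, η)` between the `K`-algebras `A` and `B`. The two commuting
diagrams are written out on pure tensors, which determine them because `ε`, `η` are bijective. -/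
structure MoritaContext (K : Type v) (A B : Type u) [Field K] [Ring A] [Algebra K A]
    [Ring B] [Algebra K B] where
  /-- the `(B, A)`-bimodule -/
  M : Type u
  /-- the `(A, B)`-bimodule -/
  N : Type u
  [addCommGroupM : AddCommGroup M]
  [leftM : Module B M]
  [rightM : Module Aᵐᵒᵖ M]
  [bimoduleM : IsBimodule K B A M]
  [addCommGroupN : AddCommGroup N]
  [leftN : Module A N]
  [rightN : Module Bᵐᵒᵖ N]
  [bimoduleN : IsBimodule K A B N]
  /-- the isomorphism `N ⊗_B M → A` of `(A, A)`-bimodules -/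
  ε : BimoduleIso A A (BalTensor B N M) A
  /-- the isomorphism `B → M ⊗_A N` of `(B, B)`-bimodules -/
  η : BimoduleIso B B B (BalTensor A M N)
  /-- The composites `M ⊗_A N ⊗_B M ⟶ M` through `M ⊗_A A` (by `id ⊗ ε`) and
  through `B ⊗_B M` (by `η⁻¹ ⊗ id`) agree. -/
  triangle_M : ∀ (m : M) (n : N) (m' : M),
    op (ε.toLinearEquiv (BalTensor.tmul B n m')) • m =
      η.toLinearEquiv.symm (BalTensor.tmul A m n) • m'
  /-- The composites `N ⊗_B M ⊗_A N ⟶ N` through `A ⊗_A N` (by `ε ⊗ id`) and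
  through `N ⊗_B B` (by `id ⊗ η⁻¹`) agree. -/
  triangle_N : ∀ (n : N) (m : M) (n' : N),
    ε.toLinearEquiv (BalTensor.tmul B n m) • n' =
      op (η.toLinearEquiv.symm (BalTensor.tmul A m n')) • n

namespace MoritaContext

variable {K : Type v} {A B : Type u} [Field K] [Ring A] [Algebra K A] [Ring B] [Algebra K B]

attribute [instance] addCommGroupM leftM rightM bimoduleM addCommGroupN leftN rightN bimoduleN

/-- Compatibility of a Morita context with Frobenius forms: if `ε⁻¹(1) = ∑ i, n i ⊗ m i`, then
`lamA a = ∑ i, lamB (η⁻¹ (m i . a ⊗ n i))` for all `a`. -/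
def Compatible (C : MoritaContext K A B) (lamA : SymmFrobeniusForm K A)
    (lamB : SymmFrobeniusForm K B) : Prop :=
  ∀ (r : ℕ) (n : Fin r → C.N) (m : Fin r → C.M),
    C.ε.toLinearEquiv.symm 1 = ∑ i, BalTensor.tmul B (n i) (m i) →
    ∀ a : A, lamA.form a =
      ∑ i, lamB.form (C.η.toLinearEquiv.symm (BalTensor.tmul A (op a • m i) (n i)))

theorem exists_tmul_sum {A M X : Type*} [Ring A] [AddCommGroup M] [Module Aᵐᵒᵖ M]
    [AddCommGroup X] [Module A X] (z : BalTensor A M X) :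
    ∃ (r : ℕ) (m : Fin r → M) (x : Fin r → X), z = ∑ i, BalTensor.tmul A (m i) (x i) := by
  induction z using BalTensor.induction_on with
  | zero => exact ⟨0, Fin.elim0, Fin.elim0, by simp⟩
  | tmul m x => exact ⟨1, fun _ => m, fun _ => x, by simp⟩
  | add y z hy hz =>
    obtain ⟨r, m, x, rfl⟩ := hy
    obtain ⟨s, m', x', rfl⟩ := hz
    exact ⟨r + s, Fin.append m m', Fin.append x x', by simp [Fin.sum_univ_add]⟩

/-- The bimodule `M` of a Morita context is finitely generated over `B`. -/
instance finite_M (C : MoritaContext K A B) : Module.Finite B C.M := by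
  classical
  obtain ⟨r, n, m, h⟩ := exists_tmul_sum (C.ε.toLinearEquiv.symm 1)
  refine ⟨⟨Finset.univ.image m, ?_⟩⟩
  rw [eq_top_iff]
  rintro x -
  have h1 : (1 : A) = ∑ i, C.ε.toLinearEquiv (BalTensor.tmul B (n i) (m i)) := by
    rw [← map_sum, ← h, LinearEquiv.apply_symm_apply]
  have h2 : x = ∑ i, C.η.toLinearEquiv.symm (BalTensor.tmul A x (n i)) • m i := by
    conv_lhs => rw [← one_smul Aᵐᵒᵖ x, ← op_one, h1, Finset.op_sum, Finset.sum_smul]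
    exact Finset.sum_congr rfl fun i _ => C.triangle_M x (n i) (m i)
  rw [h2]
  exact Submodule.sum_mem _ fun i _ => Submodule.smul_mem _ _
    (Submodule.subset_span (by simp))

/-- `M ⊗_A X` is finitely generated over `B` if `M` is so and `X` is finitely generated. -/
theorem finite_balTensor (A B M X : Type*) [Ring A] [Ring B] [AddCommGroup M] [Module B M]
    [Module Aᵐᵒᵖ M] [SMulCommClass B Aᵐᵒᵖ M] [AddCommGroup X] [Module A X]
    [Module.Finite B M] [Module.Finite A X] : Module.Finite B (BalTensor A M X) := by
  classical
  obtain ⟨s, hs⟩ := Module.Finite.fg_top (R := B) (M := M)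
  obtain ⟨t, ht⟩ := Module.Finite.fg_top (R := A) (M := X)
  refine ⟨⟨(s ×ˢ t).image (fun p => BalTensor.tmul A p.1 p.2), ?_⟩⟩
  set W := Submodule.span B
    (((s ×ˢ t).image (fun p => BalTensor.tmul A p.1 p.2) : Finset _) : Set (BalTensor A M X))
    with hW
  have h1 : ∀ (m : M), ∀ x ∈ t, BalTensor.tmul A m x ∈ W := by
    intro m x hx
    have hm : m ∈ Submodule.span B (s : Set M) := hs ▸ Submodule.mem_top
    induction hm using Submodule.span_induction with
    | mem m hm =>
      refine Submodule.subset_span ?_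
      simp only [Finset.coe_image, Set.mem_image, Finset.mem_coe, Finset.mem_product]
      exact ⟨(m, x), ⟨hm, hx⟩, rfl⟩
    | zero =>
      have : BalTensor.tmul A (0 : M) x = 0 :=
        map_zero ((BalTensor.tmulHom (A := A) (M := M) (X := X)).flip x)
      rw [this]; exact W.zero_mem
    | add p q _ _ hp hq => rw [BalTensor.add_tmul]; exact W.add_mem hp hq
    | smul b p _ hp => rw [← BalTensor.left_smul_tmul]; exact W.smul_mem b hp
  have h2 : ∀ (x : X) (m : M), BalTensor.tmul A m x ∈ W := by
    intro x
    have hx : x ∈ Submodule.span A (t : Set X) := ht ▸ Submodule.mem_top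
    induction hx using Submodule.span_induction with
    | mem x hx => exact fun m => h1 m x hx
    | zero => intro m; rw [BalTensor.tmul_zero]; exact W.zero_mem
    | add p q _ _ hp hq => intro m; rw [BalTensor.tmul_add]; exact W.add_mem (hp m) (hq m)
    | smul a p _ hp => intro m; rw [← BalTensor.smul_tmul]; exact hp _
  rw [eq_top_iff]
  rintro z -
  induction z using BalTensor.induction_on with
  | zero => exact W.zero_mem
  | tmul m x => exact h2 x m
  | add y z hy hz => exact W.add_mem hy hz

instance (C : MoritaContext K A B) (X : Type*) [AddCommGroup X] [Module A X]
    [Module.Finite A X] : Module.Finite B (BalTensor A C.M X) :=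
  finite_balTensor A B C.M X

/-- The functor `M ⊗_A -` from finitely generated left `A`-modules to finitely generated left
`B`-modules given by a Morita context. -/
def repFG (C : MoritaContext K A B) : FGModuleCat.{u} A ⥤ FGModuleCat.{u} B where
  obj X := FGModuleCat.of B (BalTensor A C.M X)
  map f := FGModuleCat.ofHom (BalTensor.lTensor B C.M f.hom.hom)
  map_id X := by
    refine FGModuleCat.hom_ext (LinearMap.ext fun z => ?_)
    induction z using BalTensor.induction_on with
    | zero => simp only [map_zero]
    | tmul m x => rfl
    | add y z hy hz => rw [map_add, map_add, hy, hz]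
  map_comp f g := by
    refine FGModuleCat.hom_ext (LinearMap.ext fun z => ?_)
    induction z using BalTensor.induction_on with
    | zero => simp only [map_zero]
    | tmul m x => rfl
    | add y z hy hz => rw [map_add, map_add, hy, hz]

end MoritaContext

/-! ### Calabi-Yau structures -/

/-- A Calabi-Yau structure (a trace) on a `K`-linear category. -/
structure CalabiYauStructure (K : Type*) [Field K] (C : Type*) [Category* C] [Preadditive C]
    [Linear K C] where
  /-- the trace on the endomorphisms of `c` -/
  tr : ∀ c : C, (c ⟶ c) →ₗ[K] K
  cyclic : ∀ {c d : C} (f : c ⟶ d) (g : d ⟶ c), tr c (f ≫ g) = tr d (g ≫ f)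
  nondegenerate_left : ∀ {c d : C} (f : c ⟶ d), (∀ g : d ⟶ c, tr c (f ≫ g) = 0) → f = 0
  nondegenerate_right : ∀ {c d : C} (g : d ⟶ c), (∀ f : c ⟶ d, tr c (f ≫ g) = 0) → g = 0

/-- A functor between categories with Calabi-Yau structures that preserves the traces. -/
def IsCalabiYauFunctor {K : Type*} [Field K] {C D : Type*} [Category* C] [Preadditive C]
    [Linear K C] [Category* D] [Preadditive D] [Linear K D] (trC : CalabiYauStructure K C)
    (trD : CalabiYauStructure K D) (F : C ⥤ D) : Prop :=
  ∀ (c : C) (f : c ⟶ c), trC.tr c f = trD.tr (F.obj c) (F.map f)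

/-! ### The trace on finitely generated modules over a semisimple symmetric Frobenius algebra -/

section Trace

variable (A : Type*) [Ring A] (P Q : Type*) [AddCommGroup P] [Module A P]
  [AddCommGroup Q] [Module A Q]

/-- The map `Ψ : P* ⊗_A Q → Hom_A(P, Q)`, `f ⊗ q ↦ (x ↦ f(x).q)`, where `P* = Hom_A(P, A)` is a
right `A`-module by `(f.a)(x) = f(x) a`. -/
def dualTensorHomA : BalTensor A (P →ₗ[A] A) Q →+ (P →ₗ[A] Q) :=
  BalTensor.lift
    (AddMonoidHom.mk' (fun f => AddMonoidHom.mk' (fun q => f.smulRight q)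
      (fun q q' => by ext x; simp)) (fun f f' => by ext q x; simp [add_smul]))
    (fun f a q => by ext x; simp [mul_smul])

@[simp]
theorem dualTensorHomA_tmul (f : P →ₗ[A] A) (q : Q) (x : P) :
    dualTensorHomA A P Q (BalTensor.tmul A f q) x = f x • q := rfl

theorem exists_dualBasis [Module.Finite A P] [Module.Projective A P] :
    ∃ (r : ℕ) (f : Fin r → (P →ₗ[A] A)) (p : Fin r → P), ∀ x, x = ∑ i, f i x • p i := by
  obtain ⟨r, s, t, -, -, h⟩ := Module.Finite.exists_comp_eq_id_of_projective A P
  refine ⟨r, fun i => (LinearMap.proj i).comp t, fun i => s (Pi.single i 1), fun x => ?_⟩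
  have hx : s (t x) = x := LinearMap.congr_fun h x
  conv_lhs => rw [← hx, pi_eq_sum_univ' (t x)]
  simp [map_sum]

variable {A P} in
theorem sum_tmul_dualTensorHomA {r : ℕ} {f : Fin r → (P →ₗ[A] A)} {p : Fin r → P}
    (h : ∀ x, x = ∑ i, f i x • p i) (z : BalTensor A (P →ₗ[A] A) Q) :
    ∑ i, BalTensor.tmul A (f i) (dualTensorHomA A P Q z (p i)) = z := by
  induction z using BalTensor.induction_on with
  | zero => simp [BalTensor.tmul_zero]
  | tmul g q =>
    simp only [dualTensorHomA_tmul, ← BalTensor.smul_tmul, ← BalTensor.sum_tmul]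
    congr 1
    ext x
    conv_rhs => rw [h x]
    simp
  | add y z hy hz =>
    simp only [map_add, LinearMap.add_apply, BalTensor.tmul_add, Finset.sum_add_distrib, hy, hz]

variable {A P} in
theorem dualTensorHomA_sum {r : ℕ} {f : Fin r → (P →ₗ[A] A)} {p : Fin r → P}
    (h : ∀ x, x = ∑ i, f i x • p i) (g : P →ₗ[A] Q) :
    dualTensorHomA A P Q (∑ i, BalTensor.tmul A (f i) (g (p i))) = g := by
  ext x
  conv_rhs => rw [h x]
  simp [map_sum, LinearMap.sum_apply]

/-- For `P` finitely generated projective, `Ψ` is an isomorphism. -/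
def dualTensorEquivA [Module.Finite A P] [Module.Projective A P] :
    BalTensor A (P →ₗ[A] A) Q ≃+ (P →ₗ[A] Q) :=
  AddEquiv.ofBijective (dualTensorHomA A P Q) (by
    obtain ⟨r, f, p, h⟩ := exists_dualBasis A P
    refine ⟨fun y z hyz => ?_, fun g => ⟨_, dualTensorHomA_sum Q h g⟩⟩
    rw [← sum_tmul_dualTensorHomA Q h y, ← sum_tmul_dualTensorHomA Q h z, hyz])

variable {A}
variable {K : Type*} [Field K] [Algebra K A] (lam : SymmFrobeniusForm K A)

/-- The composite of the evaluation `P* ⊗_A P → A`, `f ⊗ p ↦ f(p)`, and the Frobenius form.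
(The evaluation is well defined only modulo commutators; the composite is well defined as the
Frobenius form is symmetric.) -/
def frobeniusEval : BalTensor A (P →ₗ[A] A) P →+ K :=
  BalTensor.lift
    (AddMonoidHom.mk' (fun f => AddMonoidHom.mk' (fun p => lam.form (f p))
      (fun q q' => by simp)) (fun f f' => by ext q; simp))
    (fun f a q => by
      change lam.form (f q * a) = lam.form (f (a • q))
      rw [map_smul, smul_eq_mul, lam.symm])

@[simp]
theorem frobeniusEval_tmul (f : P →ₗ[A] A) (p : P) :
    frobeniusEval P lam (BalTensor.tmul A f p) = lam.form (f p) := rfl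

/-- The trace `End_A(P) → P* ⊗_A P → A → K`, the composite of `Ψ⁻¹`, evaluation and the
Frobenius form. -/
def frobeniusTrace [Module.Finite A P] [Module.Projective A P] : (P →ₗ[A] P) →+ K :=
  (frobeniusEval P lam).comp (dualTensorEquivA A P P).symm.toAddMonoidHom

variable {P} in
theorem frobeniusTrace_eq [Module.Finite A P] [Module.Projective A P] {r : ℕ}
    {f : Fin r → (P →ₗ[A] A)} {p : Fin r → P} (h : ∀ x, x = ∑ i, f i x • p i) (g : P →ₗ[A] P) :
    frobeniusTrace P lam g = ∑ i, lam.form (f i (g (p i))) := by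
  have : (dualTensorEquivA A P P).symm g = ∑ i, BalTensor.tmul A (f i) (g (p i)) := by
    rw [AddEquiv.symm_apply_eq]
    exact (dualTensorHomA_sum P h g).symm
  change frobeniusEval P lam ((dualTensorEquivA A P P).symm g) = _
  simp [this, map_sum]

variable {P} in
theorem frobeniusTrace_smulRight [Module.Finite A P] [Module.Projective A P]
    (f : P →ₗ[A] A) (p : P) : frobeniusTrace P lam (f.smulRight p) = lam.form (f p) := by
  have : (dualTensorEquivA A P P).symm (f.smulRight p) = BalTensor.tmul A f p := by
    rw [AddEquiv.symm_apply_eq]; rfl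
  change frobeniusEval P lam ((dualTensorEquivA A P P).symm (f.smulRight p)) = _
  simp [this]

variable {P Q} in
theorem frobeniusTrace_comm [Module.Finite A P] [Module.Projective A P] [Module.Finite A Q]
    [Module.Projective A Q] (f : P →ₗ[A] Q) (g : Q →ₗ[A] P) :
    frobeniusTrace P lam (g ∘ₗ f) = frobeniusTrace Q lam (f ∘ₗ g) := by
  obtain ⟨r, φ, p, hp⟩ := exists_dualBasis A P
  have h1 : g ∘ₗ f = ∑ i, (φ i ∘ₗ g ∘ₗ f).smulRight (p i) := by
    ext x
    conv_lhs => rw [hp ((g ∘ₗ f) x)]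
    simp
  have h2 : f ∘ₗ g = ∑ i, (φ i ∘ₗ g).smulRight (f (p i)) := by
    ext x
    conv_lhs => rw [LinearMap.comp_apply, hp (g x)]
    simp
  rw [h1, h2, map_sum, map_sum]
  simp [frobeniusTrace_smulRight]

end Trace

section FGModules

variable {K : Type v} {A : Type u} [Field K] [Ring A] [Algebra K A] [IsSemisimpleRing A]

theorem projective_fgModuleCat (X : FGModuleCat.{u} A) : Module.Projective A X :=
  Module.projective_of_isSemisimpleRing A X

attribute [local instance] projective_fgModuleCat

/-- The Calabi-Yau structure on the category of finitely generated modules over a semisimple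
symmetric Frobenius algebra. -/
def SymmFrobeniusForm.calabiYau (lam : SymmFrobeniusForm K A) :
    CalabiYauStructure K (FGModuleCat.{u} A) where
  tr X :=
    { toFun := fun f => frobeniusTrace X lam f.hom.hom
      map_add' := fun f g => map_add (frobeniusTrace X lam) f.hom.hom g.hom.hom
      map_smul' := fun k f => by
        obtain ⟨r, φ, p, hp⟩ := exists_dualBasis A X
        rw [frobeniusTrace_eq lam hp, frobeniusTrace_eq lam hp, RingHom.id_apply, smul_eq_mul,
          Finset.mul_sum]
        refine Finset.sum_congr rfl fun i _ => ?_
        have : (k • f).hom.hom (p i) = algebraMap K A k • f.hom.hom (p i) := rfl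
        rw [this, map_smul, smul_eq_mul, ← Algebra.smul_def, map_smul, smul_eq_mul] }
  cyclic f g := frobeniusTrace_comm lam f.hom.hom g.hom.hom
  nondegenerate_left {X Y} f hf := by
    have key : ∀ (ψ : Y →ₗ[A] A) (x : X), lam.form (ψ (f.hom.hom x)) = 0 := by
      intro ψ x
      have h := hf (FGModuleCat.ofHom (ψ.smulRight x))
      have h' : frobeniusTrace X lam ((ψ ∘ₗ f.hom.hom).smulRight x) = 0 := h
      rwa [frobeniusTrace_smulRight] at h'
    have key2 : ∀ (ψ : Y →ₗ[A] A) (x : X), ψ (f.hom.hom x) = 0 := fun ψ x =>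
      lam.nondegenerate.1 _ fun b => key (op b • ψ) x
    obtain ⟨r, φ, p, hp⟩ := exists_dualBasis A Y
    refine FGModuleCat.hom_ext (LinearMap.ext fun x => ?_)
    rw [hp (f.hom.hom x)]
    exact Finset.sum_eq_zero fun i _ => by rw [key2, zero_smul]
  nondegenerate_right {X Y} g hg := by
    have key : ∀ (ψ : X →ₗ[A] A) (y : Y), lam.form (ψ (g.hom.hom y)) = 0 := by
      intro ψ y
      have h := hg (FGModuleCat.ofHom (ψ.smulRight y))
      have h' : frobeniusTrace X lam (g.hom.hom ∘ₗ ψ.smulRight y) = 0 := h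
      have h2 : g.hom.hom ∘ₗ ψ.smulRight y = ψ.smulRight (g.hom.hom y) := by
        ext x; simp
      rwa [h2, frobeniusTrace_smulRight] at h'
    have key2 : ∀ (ψ : X →ₗ[A] A) (y : Y), ψ (g.hom.hom y) = 0 := fun ψ y =>
      lam.nondegenerate.1 _ fun b => key (op b • ψ) y
    obtain ⟨r, φ, p, hp⟩ := exists_dualBasis A X
    refine FGModuleCat.hom_ext (LinearMap.ext fun y => ?_)
    rw [hp (g.hom.hom y)]
    exact Finset.sum_eq_zero fun i _ => by rw [key2, zero_smul]

end FGModules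

end

noncomputable section

/-! ### The Morita context of a progenerator -/

/-! This is the Eilenberg–Watts argument with traces carried along. Put `M = F(A)`. Endomorphisms of
the left module `A` are right multiplications, so functoriality makes `M` a `(B, A)`-bimodule. There
is a natural map `F(A) ⊗_A X → F(X)`, `m ⊗ x ↦ F(a ↦ a.x)(m)`. A finite dual basis of `X` writes its
identity as a sum of maps through `A`, and applying `F` yields an inverse (`tensorHom_bijective`);
semisimplicity makes every finitely generated `X` projective.

To complete `M` to a Morita context, take `N = Hom_B(M, B)`. Since `F` is fully faithful, right
multiplication identifies `A` with `End_B(M)` (`rightMulHom_bijective`), so `ε` is `N ⊗_B M ≃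
End_B(M) ≃ A`. Since `F` is essentially surjective, `1 ∈ B` is a sum of values `n(m)`
(`exists_sum_eq_one`), which makes the evaluation `M ⊗_A N → B` bijective; its inverse is `η`.

For compatibility, `ε⁻¹(1) = ∑ n i ⊗ m i` says exactly that the `n i`, `m i` form a dual basis of
`M`, so `∑ lamB (n i (m i . a))` is the trace of right multiplication by `a` on `F(A)`. As `F`
preserves traces, this is the trace of right multiplication by `a` on `A`, namely `lamA a`. -/

theorem BalTensor.zero_tmul {A M X : Type*} [Ring A] [AddCommGroup M] [Module Aᵐᵒᵖ M]
    [AddCommGroup X] [Module A X] (x : X) : tmul A (0 : M) x = 0 :=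
  map_zero ((tmulHom (A := A) (M := M) (X := X)).flip x)

/-- The dual `Hom_B(M, B)` of a `(B, A)`-bimodule `M`, regarded as an `(A, B)`-bimodule. -/
def BimoduleDual (_A B M : Type*) [Ring B] [AddCommGroup M] [Module B M] : Type _ := M →ₗ[B] B

/-! ### The dual bimodule -/

namespace BimoduleDual

variable {A B M : Type*} [Ring B] [AddCommGroup M] [Module B M]

instance : AddCommGroup (BimoduleDual A B M) := inferInstanceAs (AddCommGroup (M →ₗ[B] B))

instance : FunLike (BimoduleDual A B M) M B := inferInstanceAs (FunLike (M →ₗ[B] B) M B)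

instance : LinearMapClass (BimoduleDual A B M) B M B :=
  inferInstanceAs (LinearMapClass (M →ₗ[B] B) B M B)

@[ext]
theorem ext {f g : BimoduleDual A B M} (h : ∀ m, f m = g m) : f = g := DFunLike.ext _ _ h

/-- The right action `(f.b)(m) = f(m) b`. -/
instance : Module Bᵐᵒᵖ (BimoduleDual A B M) := inferInstanceAs (Module Bᵐᵒᵖ (M →ₗ[B] B))

theorem right_smul_apply (b : B) (f : BimoduleDual A B M) (m : M) : (op b • f) m = f m * b := rfl

variable (A B M) in
/-- The isomorphism `Hom_B(M, B) ⊗_B M → End_B(M)`, `f ⊗ m ↦ (x ↦ f(x).m)`. -/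
def tensorEnd [Module.Finite B M] [Module.Projective B M] :
    BalTensor B (BimoduleDual A B M) M ≃+ (M →ₗ[B] M) := dualTensorEquivA B M M

@[simp]
theorem tensorEnd_tmul [Module.Finite B M] [Module.Projective B M]
    (f : BimoduleDual A B M) (m x : M) :
    tensorEnd A B M (BalTensor.tmul B f m) x = f x • m := rfl

variable [Ring A] [Module Aᵐᵒᵖ M]

/-- The left action `(a.f)(m) = f(m.a)`. -/
instance [SMulCommClass B Aᵐᵒᵖ M] : Module A (BimoduleDual A B M) where
  smul a f := LinearMap.comp (show M →ₗ[B] B from f) (BalTensor.rightMul (op a))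
  one_smul f := ext fun m => congrArg f (one_smul Aᵐᵒᵖ m)
  mul_smul a b f := ext fun m => congrArg f (mul_smul (op b) (op a) m)
  smul_zero _ := rfl
  smul_add _ _ _ := rfl
  add_smul a b f := ext fun m => (congrArg f (add_smul (op a) (op b) m)).trans (map_add f _ _)
  zero_smul f := ext fun m => (congrArg f (zero_smul Aᵐᵒᵖ m)).trans (map_zero f)

theorem left_smul_apply [SMulCommClass B Aᵐᵒᵖ M] (a : A) (f : BimoduleDual A B M) (m : M) :
    (a • f) m = f (op a • m) := rfl

instance [SMulCommClass B Aᵐᵒᵖ M] : SMulCommClass A Bᵐᵒᵖ (BimoduleDual A B M) where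
  smul_comm _ _ _ := rfl

theorem isBimodule (K : Type*) [Field K] [Algebra K A] [Algebra K B] [IsBimodule K B A M] :
    IsBimodule K A B (BimoduleDual A B M) where
  central k f := ext fun m => by
    rw [left_smul_apply, right_smul_apply, ← IsBimodule.central (B := B), map_smul, smul_eq_mul,
      Algebra.commutes]

/-! ### Bijectivity of the evaluation -/

section Evaluation

variable [SMulCommClass B Aᵐᵒᵖ M]

variable (A B M) in
/-- The evaluation `M ⊗_A Hom_B(M, B) → B` as an additive map. -/
def evaluationHom : BalTensor A M (BimoduleDual A B M) →+ B :=
  BalTensor.lift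
    (AddMonoidHom.mk' (fun m => AddMonoidHom.mk' (fun f : BimoduleDual A B M => f m)
      (fun _ _ => rfl)) (fun m m' => by ext f; exact map_add f m m'))
    (fun _ _ _ => rfl)

variable (A B M) in
/-- The evaluation `M ⊗_A Hom_B(M, B) → B`. -/
def evaluation : BalTensor A M (BimoduleDual A B M) →ₗ[B] B where
  __ := evaluationHom A B M
  map_smul' b z := by
    change evaluationHom A B M (b • z) = b * evaluationHom A B M z
    induction z using BalTensor.induction_on with
    | zero => rw [smul_zero, map_zero, mul_zero]
    | tmul m f => exact map_smul f b m
    | add y z hy hz => rw [smul_add, map_add, map_add, mul_add, hy, hz]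

@[simp]
theorem evaluation_tmul (m : M) (f : BimoduleDual A B M) :
    evaluation A B M (BalTensor.tmul A m f) = f m := rfl

theorem evaluation_right_smul (b : B) (z : BalTensor A M (BimoduleDual A B M)) :
    evaluation A B M (op b • z) = op b • evaluation A B M z := by
  induction z using BalTensor.induction_on with
  | zero => simp only [smul_zero, map_zero]
  | tmul m f => rfl
  | add y z hy hz => rw [smul_add, map_add, map_add, smul_add, hy, hz]

/-- The evaluation is bijective if its image contains `1` and every endomorphism `x ↦ f(x).m` of
`M` is right multiplication by an element of `A`. -/
theorem evaluation_bijective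
    (hr : ∀ (f : BimoduleDual A B M) (m : M), ∃ a : A, ∀ x : M, op a • x = f x • m)
    {r : ℕ} {n : Fin r → BimoduleDual A B M} {m : Fin r → M} (h : ∑ i, n i (m i) = 1) :
    Function.Bijective (evaluation A B M) := by
  -- An explicit left inverse, `b ↦ ∑ b.(m i) ⊗ n i`. On `x ⊗ f`, write `f(x).(m i) = x.a` and move
  -- `a` across the tensor sign: `(a.(n i))(y) = n i (f(y).(m i)) = f(y) n i (m i)`, so the terms
  -- add up to `x ⊗ f`.
  have key : ∀ z, ∑ i, BalTensor.tmul A (evaluation A B M z • m i) (n i) = z := by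
    intro z
    induction z using BalTensor.induction_on with
    | zero =>
      exact Finset.sum_eq_zero fun i _ => by rw [map_zero, zero_smul, BalTensor.zero_tmul]
    | tmul x f =>
      have hf : f = ∑ i, op (n i (m i)) • f := by
        rw [← Finset.sum_smul, ← Finset.op_sum, h, op_one, one_smul]
      conv_rhs => rw [hf, BalTensor.tmul_sum]
      refine Finset.sum_congr rfl fun i _ => ?_
      obtain ⟨a, ha⟩ := hr f (m i)
      rw [evaluation_tmul, ← ha, BalTensor.smul_tmul]
      congr 1
      ext y
      rw [left_smul_apply, ha, map_smul, right_smul_apply, smul_eq_mul]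
    | add y z hy hz =>
      conv_rhs => rw [← hy, ← hz]
      simp only [map_add, add_smul, BalTensor.add_tmul, Finset.sum_add_distrib]
  refine ⟨(injective_iff_map_eq_zero _).2 fun z hz => ?_, fun b => ?_⟩
  · rw [← key z]
    exact Finset.sum_eq_zero fun i _ => by rw [hz, zero_smul, BalTensor.zero_tmul]
  · refine ⟨b • ∑ i, BalTensor.tmul A (m i) (n i), ?_⟩
    rw [map_smul, map_sum]
    simp [h]

end Evaluation

/-! ### Endomorphisms as right multiplications -/

section Endomorphisms

variable [Module.Finite B M] [Module.Projective B M]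

variable [SMulCommClass B Aᵐᵒᵖ M]

/-- The left action of `A` on the tensor product becomes precomposition with right multiplication,
and the right action becomes postcomposition. These match left and right multiplication in `A`
because `x.(ac) = (x.a).c`. -/
theorem tensorEnd_left_smul (a : A) (z : BalTensor B (BimoduleDual A B M) M) (x : M) :
    tensorEnd A B M (a • z) x = tensorEnd A B M z (op a • x) := by
  induction z using BalTensor.induction_on with
  | zero => rw [smul_zero, map_zero]; rfl
  | tmul f m => rfl
  | add y z hy hz =>
    rw [smul_add, map_add, map_add, LinearMap.add_apply, LinearMap.add_apply, hy, hz]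

theorem tensorEnd_right_smul (a : A) (z : BalTensor B (BimoduleDual A B M) M) (x : M) :
    tensorEnd A B M (op a • z) x = op a • tensorEnd A B M z x := by
  induction z using BalTensor.induction_on with
  | zero => rw [smul_zero, map_zero, LinearMap.zero_apply, smul_zero]
  | tmul f m => rw [BalTensor.right_smul_tmul, tensorEnd_tmul, tensorEnd_tmul, smul_comm]
  | add y z hy hz =>
    rw [smul_add, map_add, map_add, LinearMap.add_apply, LinearMap.add_apply, hy, hz, smul_add]

variable (A B M) in
/-- Right multiplication `A → End_B(M)` as an additive map. -/
def rightMulHom : A →+ (M →ₗ[B] M) :=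
  AddMonoidHom.mk' (fun a => BalTensor.rightMul (op a))
    (fun a b => LinearMap.ext fun m => add_smul (op a) (op b) m)

/-- If right multiplication identifies `A` with `End_B(M)`, the composite isomorphism
`Hom_B(M, B) ⊗_B M ≃ End_B(M) ≃ A`. -/
def tensorEquiv (hA : Function.Bijective (rightMulHom A B M)) :
    BalTensor B (BimoduleDual A B M) M ≃+ A :=
  (tensorEnd A B M).trans (AddEquiv.ofBijective (rightMulHom A B M) hA).symm

/-- The defining property of `ε`: the element `ε(f ⊗ m)` acts on `M` from the right as `x ↦ f(x).m`.
Identities about `ε` are checked through this action. -/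
theorem tensorEquiv_smul (hA : Function.Bijective (rightMulHom A B M))
    (z : BalTensor B (BimoduleDual A B M) M) (x : M) :
    op (tensorEquiv hA z) • x = tensorEnd A B M z x :=
  LinearMap.congr_fun
    ((AddEquiv.ofBijective (rightMulHom A B M) hA).apply_symm_apply (tensorEnd A B M z)) x

/-- The right action of `A` on `M` is faithful, so an element of `A` is determined by how it acts.
-/
theorem tensorEquiv_eq (hA : Function.Bijective (rightMulHom A B M))
    {z : BalTensor B (BimoduleDual A B M) M} {a : A}
    (h : ∀ x : M, tensorEnd A B M z x = op a • x) : tensorEquiv hA z = a :=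
  hA.1 (LinearMap.ext fun x => (tensorEquiv_smul hA z x).trans (h x))

/-- `tensorEquiv` as an isomorphism of `(A, A)`-bimodules. -/
def tensorIso (hA : Function.Bijective (rightMulHom A B M)) :
    BimoduleIso A A (BalTensor B (BimoduleDual A B M) M) A where
  __ := tensorEquiv hA
  map_smul' a z := tensorEquiv_eq hA fun x => by
    rw [tensorEnd_left_smul, ← tensorEquiv_smul hA, RingHom.id_apply, smul_eq_mul, op_mul,
      mul_smul]
    rfl
  map_right a z := tensorEquiv_eq hA fun x => by
    rw [tensorEnd_right_smul, ← tensorEquiv_smul hA, ← mul_smul, ← op_mul]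
    rfl

/-- The inverse of the evaluation as an isomorphism of `(B, B)`-bimodules. -/
def coevaluationIso (hA : Function.Bijective (rightMulHom A B M))
    (hB : ∃ (r : ℕ) (n : Fin r → BimoduleDual A B M) (m : Fin r → M), ∑ i, n i (m i) = 1) :
    BimoduleIso B B B (BalTensor A M (BimoduleDual A B M)) :=
  have h : Function.Bijective (evaluation A B M) := by
    obtain ⟨r, n, m, h⟩ := hB
    -- The element of `A` acting as `x ↦ f(x).m` is `ε(f ⊗ m)`.
    exact evaluation_bijective (fun f m => ⟨tensorEquiv hA (BalTensor.tmul B f m), fun x => by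
      rw [tensorEquiv_smul, tensorEnd_tmul]⟩) h
  { (LinearEquiv.ofBijective (evaluation A B M) h).symm with
    map_right := fun b c => by
      change (LinearEquiv.ofBijective (evaluation A B M) h).symm (op b • c) =
        op b • (LinearEquiv.ofBijective (evaluation A B M) h).symm c
      rw [LinearEquiv.symm_apply_eq, LinearEquiv.ofBijective_apply, evaluation_right_smul,
        ← LinearEquiv.ofBijective_apply (evaluation A B M) (hf := h),
        LinearEquiv.apply_symm_apply] }

theorem coevaluationIso_symm_tmul (hA : Function.Bijective (rightMulHom A B M))
    (hB : ∃ (r : ℕ) (n : Fin r → BimoduleDual A B M) (m : Fin r → M), ∑ i, n i (m i) = 1)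
    (m : M) (n : BimoduleDual A B M) :
    (coevaluationIso hA hB).toLinearEquiv.symm (BalTensor.tmul A m n) = n m := rfl

end Endomorphisms

end BimoduleDual

/-! ### Assembling the context and comparing the forms -/

namespace MoritaContext

open BimoduleDual

variable (K : Type v) {A B M : Type u} [Field K] [Ring A] [Algebra K A] [Ring B] [Algebra K B]
  [AddCommGroup M] [Module B M] [Module Aᵐᵒᵖ M] [IsBimodule K B A M]
  [Module.Finite B M] [Module.Projective B M]

/-- The Morita context of a `(B, A)`-bimodule `M` which is a progenerator over `B` with
`A ≃ End_B(M)` by right multiplication. -/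
def ofProgenerator (hA : Function.Bijective (rightMulHom A B M))
    (hB : ∃ (r : ℕ) (n : Fin r → BimoduleDual A B M) (m : Fin r → M), ∑ i, n i (m i) = 1) :
    MoritaContext K A B where
  M := M
  N := BimoduleDual A B M
  bimoduleN := isBimodule K
  ε := tensorIso hA
  η := coevaluationIso hA hB
  triangle_M m n m' := tensorEquiv_smul hA (BalTensor.tmul B n m') m
  -- At `x`, both sides equal `n(x) n'(m)`: on the left, `n'(x.ε(n ⊗ m)) = n'(n(x).m)`.
  triangle_N n m n' := BimoduleDual.ext fun x => by
    rw [left_smul_apply, right_smul_apply, coevaluationIso_symm_tmul]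
    refine (congrArg n' (tensorEquiv_smul hA (BalTensor.tmul B n m) x)).trans ?_
    rw [tensorEnd_tmul, map_smul, smul_eq_mul]

/-- The Morita context of a progenerator is compatible with Frobenius forms if the trace of right
multiplication by `a` is the value of the form at `a`. -/
theorem ofProgenerator_compatible (hA : Function.Bijective (rightMulHom A B M))
    (hB : ∃ (r : ℕ) (n : Fin r → BimoduleDual A B M) (m : Fin r → M), ∑ i, n i (m i) = 1)
    {lamA : SymmFrobeniusForm K A} {lamB : SymmFrobeniusForm K B}
    (htr : ∀ a : A, frobeniusTrace M lamB (BalTensor.rightMul (op a)) = lamA.form a) :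
    (ofProgenerator K hA hB).Compatible lamA lamB := by
  intro r n m h a
  -- Since `ε(∑ n i ⊗ m i) = 1`, the endomorphism `x ↦ ∑ n i (x).(m i)` is right multiplication by
  -- `1`; hence `n`, `m` is a dual basis and computes the trace.
  have hx (x : M) : x = ∑ i, (show M →ₗ[B] B from n i) x • (show M from m i) := by
    have h1 : tensorEquiv hA (∑ i, BalTensor.tmul B (n i) (m i)) = 1 :=
      ((LinearEquiv.symm_apply_eq _).1 h).symm
    have h2 := tensorEquiv_smul hA (∑ i, BalTensor.tmul B (n i) (m i)) x
    rw [h1, op_one, one_smul, map_sum, LinearMap.sum_apply] at h2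
    exact h2
  rw [← htr, frobeniusTrace_eq lamB hx]
  rfl

end MoritaContext

end

noncomputable section

/-! ### The bimodule of a functor -/

namespace FGModuleCat

variable {K : Type v} {A B : Type u} [Field K] [Ring A] [Algebra K A] [Ring B] [Algebra K B]

/-- The map `A → X`, `a ↦ a.x`. -/
def ofElement {X : Type u} [AddCommGroup X] [Module A X] [Module.Finite A X] (x : X) :
    of A A ⟶ of A X :=
  ofHom (LinearMap.toSpanSingleton A X x)

/-- Naturality of the identification of `X` with `Hom_A(A, X)`. -/
theorem ofElement_comp {X Y : FGModuleCat.{u} A} (x : X) (f : X ⟶ Y) :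
    ofElement (X := X) x ≫ f = ofElement (X := Y) (f.hom.hom x) :=
  hom_ext (LinearMap.ext fun a => map_smul f.hom.hom a x)

theorem ofElement_add {X : FGModuleCat.{u} A} (x y : X) :
    ofElement (A := A) (X := X) (x + y) = ofElement (X := X) x + ofElement (X := X) y :=
  hom_ext (LinearMap.ext fun a => smul_add a x y)

theorem ofElement_one : ofElement (1 : A) = 𝟙 (of A A) :=
  hom_ext (LinearMap.ext fun a => mul_one a)

/-- Evaluation at an element, as an additive map on morphisms. -/
def evalHom {X Y : FGModuleCat.{u} A} (x : X) : (X ⟶ Y) →+ Y :=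
  AddMonoidHom.mk' (fun f => f.hom.hom x) (fun _ _ => rfl)

/-! ### The bimodule `F(A)` -/

variable (F : FGModuleCat.{u} A ⥤ FGModuleCat.{u} B)

/-- The `B`-module `F(A)`; it carries a right action of `A`. -/
def ImageBimodule : Type u := F.obj (of A A)

namespace ImageBimodule

instance : AddCommGroup (ImageBimodule F) := inferInstanceAs (AddCommGroup (F.obj (of A A)))

instance : Module B (ImageBimodule F) := inferInstanceAs (Module B (F.obj (of A A)))

instance : Module.Finite B (ImageBimodule F) :=
  inferInstanceAs (Module.Finite B (F.obj (of A A)))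

/-- The map `F(A) → F(X)` induced by `a ↦ a.x`. -/
def act {X : FGModuleCat.{u} A} (x : X) : ImageBimodule F →ₗ[B] F.obj X :=
  (F.map (ofElement (X := X) x)).hom.hom

/-- The image under `F` of `ofElement_comp`. It yields associativity of the right action,
balancedness of `m ⊗ x ↦ act F x m` and naturality in `X`. -/
theorem map_act {X Y : FGModuleCat.{u} A} (f : X ⟶ Y) (x : X) (m : ImageBimodule F) :
    (F.map f).hom.hom (act F x m) = act F (f.hom.hom x) m := by
  unfold act
  rw [← ofElement_comp, F.map_comp]
  rfl

theorem act_one : act F (X := of A A) (1 : A) = LinearMap.id := by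
  unfold act
  rw [ofElement_one, F.map_id]
  rfl

variable [F.Additive]

theorem act_add {X : FGModuleCat.{u} A} (x y : X) : act F (x + y) = act F x + act F y := by
  unfold act
  rw [ofElement_add, F.map_add]
  rfl

/-- The right action of `a` on `F(A)` is the image of right multiplication by `a`. -/
instance : Module Aᵐᵒᵖ (ImageBimodule F) where
  smul a m := act F (X := of A A) a.unop m
  one_smul m := LinearMap.congr_fun (act_one F) m
  -- Right multiplication by `a.unop` sends `b.unop` to `b.unop * a.unop`, which is `(a * b).unop`.
  mul_smul a b m := (map_act F (X := of A A) (Y := of A A) (ofElement a.unop) b.unop m).symm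
  smul_zero a := map_zero _
  smul_add a := map_add _
  add_smul a b m := LinearMap.congr_fun (act_add F (X := of A A) a.unop b.unop) m
  zero_smul m := by
    have h : act F (X := of A A) (0 : A) = 0 := by
      simpa using act_add F (X := of A A) (0 : A) 0
    exact LinearMap.congr_fun h m

theorem right_smul_eq (a : A) (m : ImageBimodule F) :
    op a • m = act F (X := of A A) a m := rfl

instance : SMulCommClass B Aᵐᵒᵖ (ImageBimodule F) where
  smul_comm b a m := (map_smul (act F (X := of A A) a.unop) b m).symm

theorem act_smul {X : FGModuleCat.{u} A} (a : A) (x : X) (m : ImageBimodule F) :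
    act F x (op a • m) = act F (a • x) m :=
  map_act F (X := of A A) (ofElement (X := X) x) a m

/-- Scalars are central in `A`, so right multiplication by `k` is `k • 𝟙`, which a `K`-linear
functor preserves. -/
instance [F.Linear K] : IsBimodule K B A (ImageBimodule F) where
  central k m := by
    have h : ofElement (algebraMap K A k) = k • 𝟙 (of A A) :=
      hom_ext (LinearMap.ext fun a => (Algebra.commutes k a).symm)
    rw [right_smul_eq]
    unfold act
    rw [h, F.map_smul, F.map_id]
    rfl

/-- An endomorphism `f` of the left module `A` is right multiplication by `f(1)`, so the map in
question is `F : End_A(A) → End_B(F(A))`: faithfulness gives injectivity and fullness surjectivity.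
-/
theorem rightMulHom_bijective [F.Full] [F.Faithful] :
    Function.Bijective (BimoduleDual.rightMulHom A B (ImageBimodule F)) := by
  refine ⟨fun a b h => ?_, fun g => ?_⟩
  · have h1 : F.map (ofElement a) = F.map (ofElement b) := hom_ext h
    have h2 := congrArg (fun f : of A A ⟶ of A A => f.hom.hom 1) (F.map_injective h1)
    exact (one_mul a).symm.trans (h2.trans (one_mul b))
  · obtain ⟨f, hf⟩ := F.map_surjective (X := of A A) (Y := of A A)
      (InducedCategory.homMk (ModuleCat.ofHom g))
    refine ⟨f.hom.hom 1, ?_⟩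
    have h : ofElement (f.hom.hom (1 : A)) = f := by
      have := ofElement_comp (X := of A A) (1 : A) f
      rw [ofElement_one, Category.id_comp] at this
      exact this.symm
    have h1 : F.map (ofElement (f.hom.hom (1 : A))) = _ := (congrArg F.map h).trans hf
    exact congrArg (fun f => f.hom.hom) h1

/-- A dual basis of `X` writes the identity as a sum of endomorphisms through `A`. -/
theorem sum_dualBasis {X : FGModuleCat.{u} A} {r : ℕ} {f : Fin r → (X →ₗ[A] A)} {p : Fin r → X}
    (h : ∀ x, x = ∑ i, f i x • p i) (y : F.obj X) :
    ∑ i, act F (p i) ((F.map (ofHom (f i) : X ⟶ of A A)).hom.hom y) = y := by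
  have h1 : 𝟙 X = ∑ i, (ofHom (f i) : X ⟶ of A A) ≫ ofElement (X := X) (p i) := by
    refine hom_ext (LinearMap.ext fun x => ?_)
    exact (h x).trans (map_sum (evalHom (Y := X) x)
      (fun i => (ofHom (f i) : X ⟶ of A A) ≫ ofElement (X := X) (p i)) Finset.univ).symm
  have h2 := congrArg F.map h1
  rw [F.map_id, F.map_sum] at h2
  have h3 := congrArg (evalHom y) h2
  rw [map_sum] at h3
  refine Eq.trans (Finset.sum_congr rfl fun i _ => ?_) h3.symm
  rw [F.map_comp]
  rfl

/-- Choose `P` with `F(P) ≃ B`. As `P` is projective, its identity is a sum of maps through `A`, so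
the identity of `B` is a sum of maps through `F(A)`; evaluate it at `1`. -/
theorem exists_sum_eq_one [IsSemisimpleRing A] [F.EssSurj] :
    ∃ (r : ℕ) (n : Fin r → BimoduleDual A B (ImageBimodule F)) (m : Fin r → ImageBimodule F),
      ∑ i, n i (m i) = 1 := by
  let e : F.obj (F.objPreimage (of B B)) ≃ₗ[B] B := isoToLinearEquiv (F.objObjPreimageIso (of B B))
  have := projective_fgModuleCat (F.objPreimage (of B B))
  obtain ⟨r, f, p, h⟩ := exists_dualBasis A (F.objPreimage (of B B))
  refine ⟨r, fun i => e.toLinearMap ∘ₗ act F (p i),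
    fun i => (F.map (ofHom (f i) : _ ⟶ of A A)).hom.hom (e.symm 1), ?_⟩
  refine Eq.trans ?_ ((congrArg e (sum_dualBasis F h (e.symm 1))).trans (e.apply_symm_apply 1))
  rw [map_sum]
  rfl

/-! ### The Eilenberg–Watts isomorphism -/

/-- The canonical map `F(A) ⊗_A X → F(X)`. -/
def tensorHom (X : FGModuleCat.{u} A) : BalTensor A (ImageBimodule F) X →+ F.obj X :=
  BalTensor.lift
    (AddMonoidHom.mk' (fun m => AddMonoidHom.mk' (fun x : X => act F x m)
      (fun x y => LinearMap.congr_fun (act_add F x y) m))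
      (fun m m' => by ext x; exact map_add (act F x) m m'))
    (fun m a x => act_smul F a x m)

theorem tensorHom_lTensor {X Y : FGModuleCat.{u} A} (f : X ⟶ Y)
    (z : BalTensor A (ImageBimodule F) X) :
    tensorHom F Y (BalTensor.lTensor B (ImageBimodule F) f.hom.hom z) =
      (F.map f).hom.hom (tensorHom F X z) := by
  induction z using BalTensor.induction_on with
  | zero => simp only [map_zero]
  | tmul m x => exact (map_act F f x m).symm
  | add y z hy hz => rw [map_add, map_add, map_add, map_add, hy, hz]

theorem tensorHom_smul (X : FGModuleCat.{u} A) (b : B) (z : BalTensor A (ImageBimodule F) X) :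
    tensorHom F X (b • z) = b • tensorHom F X z := by
  induction z using BalTensor.induction_on with
  | zero => rw [smul_zero, map_zero, smul_zero]
  | tmul m x => exact map_smul (act F x) b m
  | add y z hy hz => rw [smul_add, map_add, map_add, smul_add, hy, hz]

/-- For a dual basis `f i`, `p i` of `X`, the inverse is `y ↦ ∑ F(f i)(y) ⊗ p i`. -/
theorem tensorHom_bijective (X : FGModuleCat.{u} A) [Module.Projective A X] :
    Function.Bijective (tensorHom F X) := by
  obtain ⟨r, f, p, h⟩ := exists_dualBasis A X
  let g (i : Fin r) : F.obj X →ₗ[B] ImageBimodule F :=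
    (F.map (ofHom (f i) : X ⟶ of A A)).hom.hom
  have key : ∀ z, ∑ i, BalTensor.tmul A (g i (tensorHom F X z)) (p i) = z := by
    intro z
    induction z using BalTensor.induction_on with
    | zero =>
      exact Finset.sum_eq_zero fun i _ => by rw [map_zero, map_zero, BalTensor.zero_tmul]
    | tmul m x =>
      have h1 (i : Fin r) : g i (tensorHom F X (BalTensor.tmul A m x)) = op (f i x) • m :=
        map_act F (ofHom (f i) : X ⟶ of A A) x m
      -- `∑ m.(f i x) ⊗ p i = m ⊗ ∑ (f i x).(p i) = m ⊗ x`.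
      simp only [h1, BalTensor.smul_tmul, ← BalTensor.tmul_sum, ← h x]
    | add y z hy hz =>
      conv_rhs => rw [← hy, ← hz]
      simp only [map_add, BalTensor.add_tmul, Finset.sum_add_distrib]
  refine ⟨fun y z hyz => by rw [← key y, ← key z, hyz], fun y => ?_⟩
  refine ⟨∑ i, BalTensor.tmul A (g i y) (p i), ?_⟩
  rw [map_sum]
  exact sum_dualBasis F h y

/-- The canonical isomorphism `F(A) ⊗_A X ≃ F(X)`. -/
def tensorEquiv (X : FGModuleCat.{u} A) [Module.Projective A X] :
    BalTensor A (ImageBimodule F) X ≃ₗ[B] F.obj X where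
  __ := AddEquiv.ofBijective (tensorHom F X) (tensorHom_bijective F X)
  map_smul' := tensorHom_smul F X

end ImageBimodule

end FGModuleCat

/-! ### Traces and the conclusion -/

open FGModuleCat

/-- The identity and `1` form a one-term dual basis of `A`, so the trace of right multiplication by
`a` is the form at `1 * a`. -/
theorem SymmFrobeniusForm.calabiYau_tr_ofElement {K : Type v} {A : Type u} [Field K] [Ring A]
    [Algebra K A] [IsSemisimpleRing A] (lam : SymmFrobeniusForm K A) (a : A) :
    lam.calabiYau.tr (of A A) (ofElement a) = lam.form a := by
  have h : ∀ x : A, x = ∑ _i : Fin 1, (LinearMap.id : A →ₗ[A] A) x • (1 : A) := by simp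
  have := projective_fgModuleCat (of A A)
  refine (frobeniusTrace_eq lam h _).trans ?_
  rw [Fin.sum_univ_one]
  exact congrArg lam.form (one_mul a)

end

open FGModuleCat in
theorem proposition4p2 {K : Type v} [Field K] [IsAlgClosed K]
    {A B : Type u} [Ring A] [Algebra K A] [IsSemisimpleRing A]
    [Ring B] [Algebra K B] [IsSemisimpleRing B]
    (lamA : SymmFrobeniusForm K A) (lamB : SymmFrobeniusForm K B)
    (F : FGModuleCat.{u} A ⥤ FGModuleCat.{u} B) [F.IsEquivalence] [F.Additive] [F.Linear K]
    (hF : IsCalabiYauFunctor lamA.calabiYau lamB.calabiYau F) :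
    ∃ C : MoritaContext K A B, C.Compatible lamA lamB ∧ Nonempty (C.repFG ≅ F) := by
  have (X : FGModuleCat.{u} A) : Module.Projective A X := projective_fgModuleCat X
  have : Module.Projective B (ImageBimodule F) := projective_fgModuleCat (F.obj (of A A))
  have (X : FGModuleCat.{u} A) : Module.Finite B (BalTensor A (ImageBimodule F) X) :=
    MoritaContext.finite_balTensor A B (ImageBimodule F) X
  refine ⟨MoritaContext.ofProgenerator K (ImageBimodule.rightMulHom_bijective F)
    (ImageBimodule.exists_sum_eq_one F),
    MoritaContext.ofProgenerator_compatible K _ _ fun a => ?_, ⟨NatIso.ofComponents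
      (fun X => (ImageBimodule.tensorEquiv F X).toFGModuleCatIso) fun {X Y} f => ?_⟩⟩
  -- Right multiplication by `a` on `F(A)` is by definition `F.map (ofElement a)`, so trace
  -- preservation applies directly.
  · exact (hF (of A A) (ofElement a)).symm.trans (lamA.calabiYau_tr_ofElement a)
  · exact hom_ext (LinearMap.ext (ImageBimodule.tensorHom_lTensor F f))
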